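/- Let $k$ be a finite field with $q$ elements whose characteristic is neither $2$ nor $3$. Let $\mathrm{GL}(2,k)$, and hence its subgroup $\mathrm{SL}(2,k)$, act on the space of binary cubics $P=Ax^3+Bx^2y+Cxy^2+Dy^3$ with $A,B,C,D\in k$ by $(g\cdot P)(v)=P(g^{-1}v)$, and let $\operatorname{disc}(P)=B^2C^2-4AC^3-4B^3D-27A^2D^2+18ABCD$ be the discriminant of $P$. Then the number of $\mathrm{SL}(2,k)$-orbits of binary cubics with nonzero discriminant is $2(q-1)$. The number of $\mathrm{GL}(2,k)$-orbits of binary cubics with nonzero discriminant is $9$ if $q\equiv 1 \pmod 3$ and $3$ if $q\equiv 2\pmod 3$. -/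

import Mathlib

/-- A binary cubic over `k`: a homogeneous polynomial of degree `3` in the two variables
`x = X 0`, `y = X 1`, i.e. an element of `S³((k²)*)`. -/
def BinaryCubic (k : Type*) [Field k] : Type _ :=
  {P : MvPolynomial (Fin 2) k // P.IsHomogeneous 3}

namespace BinaryCubic

/-- The linear change of variables `P(v) ↦ P(M v)`: the variable `X i` is replaced by the
linear form `∑ j, M i j * X j`. -/
noncomputable def subst {k : Type*} [Field k] (M : Matrix (Fin 2) (Fin 2) k) :
    MvPolynomial (Fin 2) k →ₐ[k] MvPolynomial (Fin 2) k :=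
  MvPolynomial.aeval (fun i => ∑ j, MvPolynomial.C (M i j) * MvPolynomial.X j)

theorem subst_one {k : Type*} [Field k] (P : MvPolynomial (Fin 2) k) :
    subst (1 : Matrix (Fin 2) (Fin 2) k) P = P := by
  have h : subst (1 : Matrix (Fin 2) (Fin 2) k) = AlgHom.id k _ := by
    apply MvPolynomial.algHom_ext
    intro i
    simp [subst, Matrix.one_apply]
  rw [h, AlgHom.id_apply]

theorem subst_mul {k : Type*} [Field k] (M N : Matrix (Fin 2) (Fin 2) k)
    (P : MvPolynomial (Fin 2) k) : subst (M * N) P = subst N (subst M P) := by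
  have h : subst (M * N) = (subst N).comp (subst M) := by
    apply MvPolynomial.algHom_ext
    intro i
    simp [subst, Matrix.mul_apply, MvPolynomial.algHom_C, Fin.sum_univ_two]
    ring
  rw [h, AlgHom.comp_apply]

theorem isHomogeneous_subst {k : Type*} [Field k] (M : Matrix (Fin 2) (Fin 2) k)
    {P : MvPolynomial (Fin 2) k} (hP : P.IsHomogeneous 3) : (subst M P).IsHomogeneous 3 := by
  have h := hP.aeval (fun i => ∑ j, MvPolynomial.C (M i j) * MvPolynomial.X j) (n := 1)
    (fun i => MvPolynomial.IsHomogeneous.sum _ _ _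
      (fun j _ => MvPolynomial.isHomogeneous_C_mul_X (M i j) j))
  simpa [subst] using h

/-- The natural action of `GL(2,k)` on binary cubics, `(g • P)(v) = P(g⁻¹ v)`; that is, the
action on `S³` induced by the transpose inverse action on linear forms. -/
noncomputable instance instMulActionGL {k : Type*} [Field k] :
    MulAction (Matrix.GeneralLinearGroup (Fin 2) k) (BinaryCubic k) where
  smul g P := ⟨subst (g⁻¹ : Matrix.GeneralLinearGroup (Fin 2) k).val P.1,
    isHomogeneous_subst _ P.2⟩
  one_smul P := Subtype.ext (by
    change subst ((1 : Matrix.GeneralLinearGroup (Fin 2) k)⁻¹).val P.1 = P.1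
    rw [inv_one]
    exact subst_one P.1)
  mul_smul g h P := Subtype.ext (by
    change subst ((g * h)⁻¹).val P.1 = subst (g⁻¹).val (subst (h⁻¹).val P.1)
    rw [mul_inv_rev, Units.val_mul]
    exact subst_mul _ _ P.1)

/-- The action of `SL(2,k)`, the restriction of that of `GL(2,k)`. -/
noncomputable instance instMulActionSL {k : Type*} [Field k] :
    MulAction (Matrix.SpecialLinearGroup (Fin 2) k) (BinaryCubic k) :=
  MulAction.compHom (BinaryCubic k)
    (Matrix.SpecialLinearGroup.toGL :
      Matrix.SpecialLinearGroup (Fin 2) k →* Matrix.GeneralLinearGroup (Fin 2) k)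

/-- The coefficient of `x ^ m * y ^ n` in `P`. -/
noncomputable def coef {k : Type*} [Field k] (P : BinaryCubic k) (m n : ℕ) : k :=
  MvPolynomial.coeff (Finsupp.single 0 m + Finsupp.single 1 n) P.1

/-- The discriminant `B²C² - 4AC³ - 4B³D - 27A²D² + 18ABCD` of the binary cubic
`A x³ + B x² y + C x y² + D y³`. -/
noncomputable def disc {k : Type*} [Field k] (P : BinaryCubic k) : k :=
  P.coef 2 1 ^ 2 * P.coef 1 2 ^ 2 - 4 * P.coef 3 0 * P.coef 1 2 ^ 3
    - 4 * P.coef 2 1 ^ 3 * P.coef 0 3 - 27 * P.coef 3 0 ^ 2 * P.coef 0 3 ^ 2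
    + 18 * P.coef 3 0 * P.coef 2 1 * P.coef 1 2 * P.coef 0 3

/-- The set of `G`-orbits of binary cubics of nonzero discriminant. -/
def orbitsDiscNeZero (G : Type*) [Group G] (k : Type*) [Field k] [MulAction G (BinaryCubic k)] :
    Set (Set (BinaryCubic k)) :=
  {O | ∃ P : BinaryCubic k, P.disc ≠ 0 ∧ O = MulAction.orbit G P}

end BinaryCubic

namespace BinaryCubic

/-! Separate the cubics by whether they have a linear factor over `k`; the discriminant, which
scales by `det ^ 6`, is the main invariant.

With a rational root, unimodular changes of variables give `α x³ + x y²`, of discriminant `-4α`. So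
`α` is a complete `SL`-invariant, while `GL` changes it exactly by sixth powers: `q - 1` and `gcd(q
- 1, 6)` orbits.

Without one, the roots generate the cubic extension `L`. Any two generators of `L` differ by a
fractional linear map, so all these cubics are `GL`-equivalent up to a scalar. Under `GL` the scalar
matters modulo cubes, giving `gcd(q - 1, 3)` orbits. Under `SL` they are the twists `μ⁻¹ P₀(μ x,
y)`, whose discriminants determine `μ` up to sign. Twists by `μ` and `-μ` are inequivalent, since an
equivalence would yield a symmetry of determinant `-1`, hence a rational root
(`hasRoot_of_transform_eq_self`). This gives `q - 1` further orbits. -/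

open MvPolynomial in
/-- The binary cubic `A x³ + B x² y + C x y² + D y³`. -/
noncomputable def ofCoef {k : Type*} [Field k] (A B C D : k) : BinaryCubic k :=
  ⟨monomial (Finsupp.single 0 3 + Finsupp.single 1 0) A
    + monomial (Finsupp.single 0 2 + Finsupp.single 1 1) B
    + monomial (Finsupp.single 0 1 + Finsupp.single 1 2) C
    + monomial (Finsupp.single 0 0 + Finsupp.single 1 3) D, by
    refine ((IsHomogeneous.add ?_ ?_).add ?_).add ?_ <;>
      exact isHomogeneous_monomial _ (by simp [map_add])⟩

/-! ### Cubics in coordinates and the action by matrices. -/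

section Coefficients

variable {k : Type*} [Field k]

theorem single_add_single_inj {m n m' n' : ℕ} :
    (Finsupp.single (0 : Fin 2) m + Finsupp.single 1 n
      = Finsupp.single 0 m' + Finsupp.single 1 n') ↔ m = m' ∧ n = n' := by
  refine ⟨fun h => ?_, fun ⟨h, h'⟩ => by rw [h, h']⟩
  have h0 := DFunLike.congr_fun h 0
  have h1 := DFunLike.congr_fun h 1
  simp at h0 h1
  exact ⟨h0, h1⟩

@[simp] theorem coef_ofCoef_three_zero (A B C D : k) : (ofCoef A B C D).coef 3 0 = A := by
  simp only [coef, ofCoef, MvPolynomial.coeff_add, MvPolynomial.coeff_monomial,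
    single_add_single_inj]
  simp

@[simp] theorem coef_ofCoef_two_one (A B C D : k) : (ofCoef A B C D).coef 2 1 = B := by
  simp only [coef, ofCoef, MvPolynomial.coeff_add, MvPolynomial.coeff_monomial,
    single_add_single_inj]
  simp

@[simp] theorem coef_ofCoef_one_two (A B C D : k) : (ofCoef A B C D).coef 1 2 = C := by
  simp only [coef, ofCoef, MvPolynomial.coeff_add, MvPolynomial.coeff_monomial,
    single_add_single_inj]
  simp

@[simp] theorem coef_ofCoef_zero_three (A B C D : k) : (ofCoef A B C D).coef 0 3 = D := by
  simp only [coef, ofCoef, MvPolynomial.coeff_add, MvPolynomial.coeff_monomial,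
    single_add_single_inj]
  simp

theorem ext_coef {P Q : BinaryCubic k} (h30 : P.coef 3 0 = Q.coef 3 0)
    (h21 : P.coef 2 1 = Q.coef 2 1) (h12 : P.coef 1 2 = Q.coef 1 2)
    (h03 : P.coef 0 3 = Q.coef 0 3) : P = Q := by
  refine Subtype.ext (MvPolynomial.ext _ _ fun d => ?_)
  by_cases hd : d.degree = 3
  · have hd' : d = Finsupp.single 0 (d 0) + Finsupp.single 1 (d 1) := by
      ext i
      fin_cases i <;> simp
    have hs : d 0 + d 1 = 3 := by
      rw [hd'] at hd
      simpa [map_add] using hd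
    have hcases : (d 0 = 3 ∧ d 1 = 0) ∨ (d 0 = 2 ∧ d 1 = 1) ∨ (d 0 = 1 ∧ d 1 = 2) ∨
        (d 0 = 0 ∧ d 1 = 3) := by omega
    rw [hd']
    rcases hcases with ⟨h, h'⟩ | ⟨h, h'⟩ | ⟨h, h'⟩ | ⟨h, h'⟩ <;> rw [h, h'] <;> assumption
  · rw [P.2.coeff_eq_zero hd, Q.2.coeff_eq_zero hd]

theorem eq_ofCoef (P : BinaryCubic k) :
    P = ofCoef (P.coef 3 0) (P.coef 2 1) (P.coef 1 2) (P.coef 0 3) :=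
  ext_coef (by simp) (by simp) (by simp) (by simp)

theorem ofCoef_val (A B C D : k) :
    (ofCoef A B C D).1 = MvPolynomial.C A * MvPolynomial.X 0 ^ 3
      + MvPolynomial.C B * MvPolynomial.X 0 ^ 2 * MvPolynomial.X 1
      + MvPolynomial.C C * MvPolynomial.X 0 * MvPolynomial.X 1 ^ 2
      + MvPolynomial.C D * MvPolynomial.X 1 ^ 3 := by
  have h (m n : ℕ) (a : k) : MvPolynomial.monomial (Finsupp.single (0 : Fin 2) m
      + Finsupp.single 1 n) a
      = MvPolynomial.C a * MvPolynomial.X 0 ^ m * MvPolynomial.X 1 ^ n := by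
    rw [MvPolynomial.X_pow_eq_monomial, MvPolynomial.X_pow_eq_monomial,
      MvPolynomial.C_mul_monomial, MvPolynomial.monomial_mul, mul_one, mul_one]
  simp only [ofCoef, h]
  ring

/-- The binary cubic `P(M v)`. -/
noncomputable def transform (M : Matrix (Fin 2) (Fin 2) k) (P : BinaryCubic k) : BinaryCubic k :=
  ⟨subst M P.1, isHomogeneous_subst M P.2⟩

theorem transform_mul (M N : Matrix (Fin 2) (Fin 2) k) (P : BinaryCubic k) :
    transform (M * N) P = transform N (transform M P) :=
  Subtype.ext (subst_mul M N P.1)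

theorem transform_one (P : BinaryCubic k) :
    transform (1 : Matrix (Fin 2) (Fin 2) k) P = P :=
  Subtype.ext (subst_one P.1)

theorem transform_ofCoef (a b c d A B C D : k) :
    transform !![a, b; c, d] (ofCoef A B C D) = ofCoef
      (A * a ^ 3 + B * a ^ 2 * c + C * a * c ^ 2 + D * c ^ 3)
      (3 * A * a ^ 2 * b + B * (a ^ 2 * d + 2 * a * b * c) + C * (2 * a * c * d + b * c ^ 2)
        + 3 * D * c ^ 2 * d)
      (3 * A * a * b ^ 2 + B * (2 * a * b * d + b ^ 2 * c) + C * (a * d ^ 2 + 2 * b * c * d)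
        + 3 * D * c * d ^ 2)
      (A * b ^ 3 + B * b ^ 2 * d + C * b * d ^ 2 + D * d ^ 3) := by
  apply Subtype.ext
  change subst _ (ofCoef A B C D).1 = _
  rw [ofCoef_val, ofCoef_val]
  have hC (r : k) : subst !![a, b; c, d] (MvPolynomial.C r) = MvPolynomial.C r :=
    MvPolynomial.algHom_C _ _
  have hX (i : Fin 2) : subst !![a, b; c, d] (MvPolynomial.X i)
      = ∑ j, MvPolynomial.C (!![a, b; c, d] i j) * MvPolynomial.X j := MvPolynomial.aeval_X _ _
  simp only [map_add, map_mul, map_pow, hC, hX, Fin.sum_univ_two, Matrix.of_apply,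
    Matrix.cons_val', Matrix.cons_val_zero, Matrix.cons_val_one, Matrix.cons_val_fin_one]
  simp only [map_ofNat]
  ring

theorem mem_orbit_GL {P Q : BinaryCubic k} :
    Q ∈ MulAction.orbit (Matrix.GeneralLinearGroup (Fin 2) k) P ↔
      ∃ M : Matrix (Fin 2) (Fin 2) k, M.det ≠ 0 ∧ transform M P = Q := by
  constructor
  · rintro ⟨g, rfl⟩
    exact ⟨(g⁻¹).val, (Matrix.isUnits_det_units g⁻¹).ne_zero, rfl⟩
  · rintro ⟨M, hM, rfl⟩
    refine ⟨(Matrix.GeneralLinearGroup.mkOfDetNeZero M hM)⁻¹, ?_⟩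
    apply Subtype.ext
    change subst ((Matrix.GeneralLinearGroup.mkOfDetNeZero M hM)⁻¹⁻¹).val P.1 = subst M P.1
    rw [inv_inv]
    rfl

theorem mem_orbit_SL {P Q : BinaryCubic k} :
    Q ∈ MulAction.orbit (Matrix.SpecialLinearGroup (Fin 2) k) P ↔
      ∃ M : Matrix (Fin 2) (Fin 2) k, M.det = 1 ∧ transform M P = Q := by
  have h (g : Matrix.SpecialLinearGroup (Fin 2) k) : g • P = transform (g⁻¹).1 P := by
    apply Subtype.ext
    change subst ((Matrix.SpecialLinearGroup.toGL g)⁻¹).val P.1 = _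
    rw [← map_inv]
    rfl
  constructor
  · rintro ⟨g, rfl⟩
    exact ⟨(g⁻¹).1, (g⁻¹).2, (h g).symm⟩
  · rintro ⟨M, hM, rfl⟩
    obtain ⟨g, rfl⟩ : ∃ g : Matrix.SpecialLinearGroup (Fin 2) k, g.1 = M := ⟨⟨M, hM⟩, rfl⟩
    exact ⟨g⁻¹, (h _).trans (by rw [inv_inv])⟩

theorem disc_ofCoef (A B C D : k) : (ofCoef A B C D).disc =
    B ^ 2 * C ^ 2 - 4 * A * C ^ 3 - 4 * B ^ 3 * D - 27 * A ^ 2 * D ^ 2 + 18 * A * B * C * D := by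
  simp [disc]

theorem disc_transform (M : Matrix (Fin 2) (Fin 2) k) (P : BinaryCubic k) :
    (transform M P).disc = M.det ^ 6 * P.disc := by
  rw [eq_ofCoef P, Matrix.eta_fin_two M, transform_ofCoef, disc_ofCoef, disc_ofCoef,
    Matrix.det_fin_two_of]
  ring

/-- The value of a binary cubic at the vector `(x, y)`, with coordinates in an extension. -/
noncomputable def value {L : Type*} [Field L] [Algebra k L] (P : BinaryCubic k) (x y : L) : L :=
  algebraMap k L (P.coef 3 0) * x ^ 3 + algebraMap k L (P.coef 2 1) * x ^ 2 * y
    + algebraMap k L (P.coef 1 2) * x * y ^ 2 + algebraMap k L (P.coef 0 3) * y ^ 3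

theorem value_transform {L : Type*} [Field L] [Algebra k L] (a b c d : k) (P : BinaryCubic k)
    (x y : L) : (transform !![a, b; c, d] P).value x y
      = P.value (algebraMap k L a * x + algebraMap k L b * y)
        (algebraMap k L c * x + algebraMap k L d * y) := by
  rw [eq_ofCoef P, transform_ofCoef]
  simp only [value, coef_ofCoef_three_zero, coef_ofCoef_two_one, coef_ofCoef_one_two,
    coef_ofCoef_zero_three, map_add, map_mul, map_pow, map_ofNat]
  ring

/-- A binary cubic has a linear factor over `k`. -/
def HasRoot (P : BinaryCubic k) : Prop :=
  ∃ x y : k, (x ≠ 0 ∨ y ≠ 0) ∧ P.value x y = 0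

theorem HasRoot.of_transform {M : Matrix (Fin 2) (Fin 2) k} (hM : M.det ≠ 0) {P : BinaryCubic k}
    (h : (transform M P).HasRoot) : P.HasRoot := by
  obtain ⟨x, y, hxy, h⟩ := h
  rw [Matrix.eta_fin_two M, value_transform] at h
  rw [Matrix.det_fin_two] at hM
  refine ⟨_, _, ?_, h⟩
  by_contra! hc
  obtain ⟨h1, h2⟩ := hc
  simp only [Algebra.algebraMap_self, RingHom.id_apply] at h1 h2
  have hx : (M 0 0 * M 1 1 - M 0 1 * M 1 0) * x = 0 := by linear_combination M 1 1 * h1 - M 0 1 * h2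
  have hy : (M 0 0 * M 1 1 - M 0 1 * M 1 0) * y = 0 := by linear_combination M 0 0 * h2 - M 1 0 * h1
  rcases hxy with hxy | hxy
  · exact (mul_ne_zero hM hxy) hx
  · exact (mul_ne_zero hM hxy) hy

theorem transform_inv_transform {M : Matrix (Fin 2) (Fin 2) k} (hM : M.det ≠ 0)
    (P : BinaryCubic k) : transform M⁻¹ (transform M P) = P := by
  rw [← transform_mul, Matrix.mul_nonsing_inv M hM.isUnit, transform_one]

theorem hasRoot_transform {M : Matrix (Fin 2) (Fin 2) k} (hM : M.det ≠ 0) {P : BinaryCubic k} :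
    (transform M P).HasRoot ↔ P.HasRoot := by
  refine ⟨HasRoot.of_transform hM, fun h => HasRoot.of_transform (M := M⁻¹) ?_ ?_⟩
  · rw [Matrix.det_nonsing_inv, Ring.inverse_eq_inv']
    exact inv_ne_zero hM
  · rwa [transform_inv_transform hM]

/-- The discriminant of the Hessian covariant is `-3` times the discriminant. -/
theorem three_mul_disc (P : BinaryCubic k) :
    3 * P.disc = 4 * (P.coef 2 1 ^ 2 - 3 * P.coef 3 0 * P.coef 1 2)
        * (P.coef 1 2 ^ 2 - 3 * P.coef 2 1 * P.coef 0 3)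
      - (P.coef 2 1 * P.coef 1 2 - 9 * P.coef 3 0 * P.coef 0 3) ^ 2 := by
  rw [disc]
  ring

theorem trace_eq_zero_of_transform_eq_self (h2 : (2 : k) ≠ 0) (h3 : (3 : k) ≠ 0) {a b c d : k}
    (hM : a * d - b * c = -1) {P : BinaryCubic k} (hP : P.disc ≠ 0)
    (h : transform !![a, b; c, d] P = P) : a + d = 0 := by
  by_contra ht
  apply mul_ne_zero h3 hP
  rw [three_mul_disc]
  obtain ⟨h0, hh0⟩ : ∃ z, z = P.coef 2 1 ^ 2 - 3 * P.coef 3 0 * P.coef 1 2 := ⟨_, rfl⟩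
  obtain ⟨h1, hh1⟩ : ∃ z, z = P.coef 2 1 * P.coef 1 2 - 9 * P.coef 3 0 * P.coef 0 3 := ⟨_, rfl⟩
  obtain ⟨h2', hh2⟩ : ∃ z, z = P.coef 1 2 ^ 2 - 3 * P.coef 2 1 * P.coef 0 3 := ⟨_, rfl⟩
  -- The Hessian `h0 x² + h1 xy + h2' y²` is a covariant of weight `det ^ 2`. Since `det ^ 2 = 1`
  -- and `M` fixes `P`, it also fixes the Hessian; `e0`, `e1`, `e2` say so coefficientwise.
  have hsq : (a * d - b * c) ^ 2 = 1 := by rw [hM]; norm_num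
  have e0 : h0 = h0 * a ^ 2 + h1 * (a * c) + h2' * c ^ 2 := by
    rw [← one_mul (_ + _), ← hsq, hh0, hh1, hh2]
    nth_rw 1 2 3 [← h]
    rw [eq_ofCoef P, transform_ofCoef]
    simp only [coef_ofCoef_three_zero, coef_ofCoef_two_one, coef_ofCoef_one_two,
      coef_ofCoef_zero_three]
    ring
  have e1 : h1 = 2 * h0 * (a * b) + h1 * (a * d + b * c) + 2 * h2' * (c * d) := by
    rw [← one_mul (_ + _), ← hsq, hh0, hh1, hh2]
    nth_rw 1 2 3 4 [← h]
    rw [eq_ofCoef P, transform_ofCoef]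
    simp only [coef_ofCoef_three_zero, coef_ofCoef_two_one, coef_ofCoef_one_two,
      coef_ofCoef_zero_three]
    ring
  have e2 : h2' = h0 * b ^ 2 + h1 * (b * d) + h2' * d ^ 2 := by
    rw [← one_mul (_ + _), ← hsq, hh0, hh1, hh2]
    nth_rw 1 2 3 [← h]
    rw [eq_ofCoef P, transform_ofCoef]
    simp only [coef_ofCoef_three_zero, coef_ofCoef_two_one, coef_ofCoef_one_two,
      coef_ofCoef_zero_three]
    ring
  -- With `S` the Gram matrix, `Mᵀ S M = S` and `M⁻¹ = -adj M` give `Mᵀ S + S adj M = 0`, whose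
  -- symmetric part is `(a + d) S`. A nonzero trace thus kills the Hessian, and with it the
  -- discriminant.
  have k0 : 2 * (a + d) * h0 = 0 := by
    linear_combination (2 * h0 * a + h1 * c) * hM + 2 * d * e0 - c * e1
  have k1 : 2 * (a + d) * h1 = 0 := by
    linear_combination (2 * h0 * b + h1 * d + h1 * a + 2 * h2' * c) * hM
      + (d + a) * e1 - 2 * c * e2 - 2 * b * e0
  have k2 : 2 * (a + d) * h2' = 0 := by
    linear_combination (h1 * b + 2 * h2' * d) * hM - b * e1 + 2 * a * e2
  have ht2 := mul_ne_zero h2 ht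
  rw [← hh0, ← hh1, ← hh2, (mul_eq_zero_iff_left ht2).1 k0, (mul_eq_zero_iff_left ht2).1 k1]
  ring

/-- Trace `0` and determinant `-1` make `M` a reflection, with a rational eigenvector for `-1`; a
cubic has odd degree, so it vanishes there. -/
theorem hasRoot_of_transform_eq_self (h2 : (2 : k) ≠ 0) (h3 : (3 : k) ≠ 0)
    {M : Matrix (Fin 2) (Fin 2) k} (hM : M.det = -1)
    {P : BinaryCubic k} (hP : P.disc ≠ 0) (h : transform M P = P) : P.HasRoot := by
  obtain ⟨a, b, c, d, rfl⟩ : ∃ a b c d, M = !![a, b; c, d] := ⟨_, _, _, _, Matrix.eta_fin_two M⟩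
  rw [Matrix.det_fin_two_of] at hM
  have htr := trace_eq_zero_of_transform_eq_self h2 h3 hM hP h
  -- A vector `v` with `M v = -v` satisfies `P v = P (M v) = -P v`.
  have key (x y : k) (hx : a * x + b * y = -x) (hy : c * x + d * y = -y) : P.value x y = 0 := by
    have hv := value_transform a b c d P x y
    simp only [Algebra.algebraMap_self, RingHom.id_apply] at hv
    rw [h, hx, hy] at hv
    have hneg : P.value (-x) (-y) = -P.value x y := by simp only [value]; ring
    rw [hneg] at hv
    exact (mul_eq_zero_iff_left h2).1 (by linear_combination hv)
  -- By Cayley–Hamilton `(M + 1)(M - 1) = 0`, so any nonzero column of `M - 1` is the eigenvector.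
  -- Both columns cannot vanish, as the identity has trace `2 ≠ 0`.
  by_cases h0 : a - 1 ≠ 0 ∨ c ≠ 0
  · exact ⟨a - 1, c, h0, key _ _ (by linear_combination a * htr - hM)
      (by linear_combination c * htr)⟩
  · push Not at h0
    refine ⟨b, d - 1, Or.inr fun hd => h2 ?_, key _ _ (by linear_combination b * htr)
      (by linear_combination d * htr - hM)⟩
    linear_combination htr - h0.1 - hd

theorem HasRoot.exists_transform_eq (h2 : (2 : k) ≠ 0) {P : BinaryCubic k} (hr : P.HasRoot)
    (hP : P.disc ≠ 0) : ∃ M : Matrix (Fin 2) (Fin 2) k, M.det = 1 ∧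
      ∃ α : k, α ≠ 0 ∧ transform M P = ofCoef α 0 1 0 := by
  obtain ⟨x, y, hxy, hv⟩ := hr
  obtain ⟨M, hM, hMP⟩ : ∃ M : Matrix (Fin 2) (Fin 2) k, M.det = 1 ∧
      (transform M P).coef 0 3 = 0 := by
    -- Complete the root to a unimodular basis as its second column: the new `y³` coefficient is the
    -- value of `P` there.
    obtain ⟨a, c, hac⟩ : ∃ a c : k, a * y - x * c = 1 := by
      rcases hxy with hx | hy
      · exact ⟨0, -x⁻¹, by field_simp; ring⟩
      · exact ⟨y⁻¹, 0, by field_simp; ring⟩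
    refine ⟨!![a, x; c, y], by rw [Matrix.det_fin_two_of, hac], ?_⟩
    rw [eq_ofCoef P, transform_ofCoef, coef_ofCoef_zero_three]
    simpa only [value, Algebra.algebraMap_self, RingHom.id_apply] using hv
  have hd : (transform M P).disc ≠ 0 := by rwa [disc_transform, hM, one_pow, one_mul]
  obtain ⟨A, B, C, hQ⟩ : ∃ A B C, transform M P = ofCoef A B C 0 :=
    ⟨_, _, _, by rw [← hMP]; exact eq_ofCoef _⟩
  rw [hQ, disc_ofCoef] at hd
  have hC : C ≠ 0 := by
    rintro rfl
    exact hd (by ring)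
  -- The lower left entry completes the square, removing `x² y`; the diagonal scales the coefficient
  -- of `x y²` to `1`.
  let N : Matrix (Fin 2) (Fin 2) k := !![C, 0; -B / 2, C⁻¹]
  have hN : N.det = 1 := by
    rw [Matrix.det_fin_two_of]
    field_simp
    ring
  obtain ⟨α, hα⟩ : ∃ α, transform (M * N) P = ofCoef α 0 1 0 := by
    refine ⟨A * C ^ 3 - B ^ 2 * C ^ 2 / 4, ?_⟩
    have h4 : (4 : k) ≠ 0 := by
      rw [show (4 : k) = 2 * 2 by norm_num]
      exact mul_ne_zero h2 h2
    rw [transform_mul, hQ, transform_ofCoef]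
    congr 1 <;> field_simp <;> ring
  refine ⟨M * N, by rw [Matrix.det_mul, hM, hN, one_mul], α, ?_, hα⟩
  rintro rfl
  have := disc_transform (M * N) P
  rw [hα, disc_ofCoef, Matrix.det_mul, hM, hN] at this
  exact hP (by linear_combination -this)

/-- A repeated root of a cubic is rational over `k`: it is the triple root `-B / (3A)`, or else the
double root of the Hessian, `-h1 / (2 h0)`. -/
theorem disc_ne_zero_of_not_hasRoot (h2 : (2 : k) ≠ 0) (h3 : (3 : k) ≠ 0) {P : BinaryCubic k}
    (hr : ¬ P.HasRoot) : P.disc ≠ 0 := by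
  intro hd
  obtain ⟨A, B, C, D, rfl⟩ : ∃ A B C D, P = ofCoef A B C D := ⟨_, _, _, _, eq_ofCoef P⟩
  rw [disc_ofCoef] at hd
  have hv (x y : k) : (ofCoef A B C D).value x y
      = A * x ^ 3 + B * x ^ 2 * y + C * x * y ^ 2 + D * y ^ 3 := by
    simp [value]
  have hA : A ≠ 0 := by
    rintro rfl
    exact hr ⟨1, 0, by simp, by simp [hv]⟩
  by_cases h0 : B ^ 2 - 3 * A * C = 0
  · refine hr ⟨-B, 3 * A, Or.inr (mul_ne_zero h3 hA), ?_⟩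
    have hB : (27 * A ^ 2 * D - B ^ 3) ^ 2 = 0 := by
      linear_combination -27 * A ^ 2 * hd +
        (B ^ 4 + 3 * A * B ^ 2 * C + 36 * A ^ 2 * C ^ 2 - 162 * A ^ 2 * B * D) * h0
    rw [hv]
    linear_combination A * (pow_eq_zero_iff two_ne_zero).1 hB + 3 * A * B * h0
  · refine hr ⟨-(B * C - 9 * A * D), 2 * (B ^ 2 - 3 * A * C), Or.inr (mul_ne_zero h2 h0), ?_⟩
    rw [hv]
    linear_combination -(2 * B ^ 3 - 9 * A * B * C + 27 * A ^ 2 * D) * hd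

end Coefficients

/-- The multiple `c P` of a binary cubic. -/
noncomputable def scale {k : Type*} [Field k] (c : k) (P : BinaryCubic k) : BinaryCubic k :=
  ofCoef (c * P.coef 3 0) (c * P.coef 2 1) (c * P.coef 1 2) (c * P.coef 0 3)

/-! ### Roots in the cubic extension. -/

section CubicExtension

variable {k : Type*} [Field k] {L : Type*} [Field L] [Algebra k L]

theorem natDegree_minpoly_of_finrank_eq_three (hL : Module.finrank k L = 3) {θ : L}
    (hθ : θ ∉ (algebraMap k L).range) : (minpoly k θ).natDegree = 3 := by
  have : FiniteDimensional k L := Module.finite_of_finrank_pos (by omega)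
  have hdvd : (minpoly k θ).natDegree ∣ 3 :=
    hL ▸ minpoly.degree_dvd (Algebra.IsIntegral.isIntegral θ)
  rcases (Nat.dvd_prime Nat.prime_three).1 hdvd with h | h
  · exact absurd (minpoly.natDegree_eq_one_iff.1 h) hθ
  · exact h

open Polynomial in
theorem eq_zero_of_quadratic_eq_zero (hL : Module.finrank k L = 3) {θ : L}
    (hθ : θ ∉ (algebraMap k L).range) {a b c : k}
    (h : algebraMap k L a * θ ^ 2 + algebraMap k L b * θ + algebraMap k L c = 0) :
    a = 0 ∧ b = 0 ∧ c = 0 := by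
  have hf : aeval θ (C a * X ^ 2 + C b * X + C c) = 0 := by simpa using h
  have hz : C a * X ^ 2 + C b * X + C c = 0 := by
    by_contra hne
    have := Polynomial.natDegree_le_of_dvd (minpoly.dvd k θ hf) hne
    rw [natDegree_minpoly_of_finrank_eq_three hL hθ] at this
    have := natDegree_quadratic_le (a := a) (b := b) (c := c)
    omega
  refine ⟨?_, ?_, ?_⟩
  · simpa [coeff_X] using congrArg (coeff · 2) hz
  · simpa [coeff_X] using congrArg (coeff · 1) hz
  · simpa [coeff_X] using congrArg (coeff · 0) hz

open Polynomial in
-- The dehomogenised cubic is irreducible, and the degree 3 field it defines embeds in `L` because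
-- finite fields are determined by their degree.
theorem exists_value_eq_zero_of_not_hasRoot [Finite L]
    (hL : Module.finrank k L = 3) {P : BinaryCubic k} (hP : ¬ P.HasRoot) :
    ∃ θ : L, θ ∉ (algebraMap k L).range ∧ P.value θ 1 = 0 := by
  have hA : P.coef 3 0 ≠ 0 := fun hA => hP ⟨1, 0, by simp, by simp [value, hA]⟩
  let f : Cubic k := ⟨P.coef 3 0, P.coef 2 1, P.coef 1 2, P.coef 0 3⟩
  have hdeg : f.toPoly.natDegree = 3 := Cubic.natDegree_of_a_ne_zero hA
  have hf : Irreducible f.toPoly := by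
    refine irreducible_of_degree_le_three_of_not_isRoot (by simp [hdeg])
      fun x hx => hP ⟨x, 1, by simp, ?_⟩
    simpa [f, Cubic.toPoly, value] using hx
  have : Fact (Irreducible f.toPoly) := ⟨hf⟩
  have hfin : Module.finrank k (AdjoinRoot f.toPoly) = 3 := by
    rw [(AdjoinRoot.powerBasis hf.ne_zero).finrank, AdjoinRoot.powerBasis_dim, hdeg]
  obtain ⟨g⟩ := FiniteField.nonempty_algHom_of_finrank_dvd (F := k) (K := AdjoinRoot f.toPoly)
    (L := L) (by rw [hfin, hL])
  have hroot : P.value (g (AdjoinRoot.root f.toPoly)) 1 = 0 := by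
    have h : aeval (g (AdjoinRoot.root f.toPoly)) f.toPoly = 0 := by
      rw [aeval_algHom_apply, AdjoinRoot.aeval_eq, AdjoinRoot.mk_self, map_zero]
    simpa [f, Cubic.toPoly, value] using h
  refine ⟨_, ?_, hroot⟩
  rintro ⟨x, hx⟩
  refine hP ⟨x, 1, by simp, (algebraMap k L).injective ?_⟩
  rw [← hx] at hroot
  simpa [value] using hroot

open Polynomial in
theorem exists_not_hasRoot_of_finrank_eq_three (hL : Module.finrank k L = 3) :
    ∃ P : BinaryCubic k, ¬ P.HasRoot := by
  have : FiniteDimensional k L := Module.finite_of_finrank_pos (by omega)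
  obtain ⟨θ, hθ⟩ : ∃ θ : L, θ ∉ (algebraMap k L).range := by
    by_contra! h
    have := finrank_eq_one (R := k) (1 : L) one_ne_zero fun w => by
      obtain ⟨x, rfl⟩ := h w
      exact ⟨x, (Algebra.algebraMap_eq_smul_one x).symm⟩
    omega
  have hint : IsIntegral k θ := Algebra.IsIntegral.isIntegral θ
  have hdeg := natDegree_minpoly_of_finrank_eq_three hL hθ
  have hmonic := minpoly.monic hint
  rw [Monic, leadingCoeff, hdeg] at hmonic
  refine ⟨ofCoef 1 ((minpoly k θ).coeff 2) ((minpoly k θ).coeff 1) ((minpoly k θ).coeff 0), ?_⟩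
  rintro ⟨x, y, hxy, h⟩
  simp only [value, coef_ofCoef_three_zero, coef_ofCoef_two_one, coef_ofCoef_one_two,
      coef_ofCoef_zero_three, Algebra.algebraMap_self, RingHom.id_apply] at h
  rcases eq_or_ne y 0 with rfl | hy
  · simp at hxy
    exact hxy (by simpa using h)
  · refine (minpoly.irreducible hint).not_isRoot_of_natDegree_ne_one (by omega) (x := x / y) ?_
    rw [IsRoot, eval_eq_sum_range, hdeg]
    simp only [Finset.sum_range_succ, Finset.sum_range_zero, hmonic]
    field_simp
    linear_combination h

/-- Two elements generating a cubic extension differ by a fractional linear transformation. -/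
theorem exists_fractional_linear (hL : Module.finrank k L = 3) {θ φ : L}
    (hθ : θ ∉ (algebraMap k L).range) (hφ : φ ∉ (algebraMap k L).range) :
    ∃ a b c d : k, a * d - b * c ≠ 0 ∧ algebraMap k L c * θ + algebraMap k L d ≠ 0 ∧
      algebraMap k L a * θ + algebraMap k L b
        = φ * (algebraMap k L c * θ + algebraMap k L d) := by
  have : FiniteDimensional k L := Module.finite_of_finrank_pos (by omega)
  -- Four vectors in a 3-dimensional space are dependent; the relation is the fractional linear
  -- equation with denominators cleared.
  let T : (Fin 4 → k) →ₗ[k] L := Fintype.linearCombination k ![θ, 1, -φ * θ, -φ]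
  have hker : LinearMap.ker T ≠ ⊥ :=
    LinearMap.ker_ne_bot_of_finrank_lt (by rw [hL, Module.finrank_fin_fun]; norm_num)
  obtain ⟨v, hv, hv0⟩ := (Submodule.ne_bot_iff _).1 hker
  have hrel : algebraMap k L (v 0) * θ + algebraMap k L (v 1)
      = φ * (algebraMap k L (v 2) * θ + algebraMap k L (v 3)) := by
    have : T v = 0 := hv
    simp only [T, Fintype.linearCombination_apply, Fin.sum_univ_four, Algebra.smul_def] at this
    simp at this
    linear_combination this
  have hlin {ψ : L} (hψ : ψ ∉ (algebraMap k L).range) {r s : k}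
      (h : algebraMap k L r * ψ + algebraMap k L s = 0) : r = 0 ∧ s = 0 :=
    (eq_zero_of_quadratic_eq_zero hL hψ (a := 0) (by simpa using h)).2
  have hne : algebraMap k L (v 2) * θ + algebraMap k L (v 3) ≠ 0 := by
    intro h0
    obtain ⟨h2, h3⟩ := hlin hθ h0
    rw [h0, mul_zero] at hrel
    obtain ⟨h0, h1⟩ := hlin hθ hrel
    exact hv0 (by ext i; fin_cases i <;> assumption)
  refine ⟨v 0, v 1, v 2, v 3, fun hdet => ?_, hne, hrel⟩
  have hd := congrArg (algebraMap k L) hdet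
  simp only [map_sub, map_mul, map_zero] at hd
  -- If the determinant vanished, `c φ = a` and `d φ = b` would follow; as `φ` is irrational, `c = d
  -- = 0`, contradicting the nonzero denominator.
  have h1 : (algebraMap k L (v 2) * φ + algebraMap k L (-v 0))
      * (algebraMap k L (v 2) * θ + algebraMap k L (v 3)) = 0 := by
    rw [map_neg]
    linear_combination (-algebraMap k L (v 2)) * hrel - hd
  have h2 : (algebraMap k L (v 3) * φ + algebraMap k L (-v 1))
      * (algebraMap k L (v 2) * θ + algebraMap k L (v 3)) = 0 := by
    rw [map_neg]
    linear_combination (-algebraMap k L (v 3)) * hrel + θ * hd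
  have h1' := hlin hφ ((mul_eq_zero_iff_right hne).1 h1)
  have h2' := hlin hφ ((mul_eq_zero_iff_right hne).1 h2)
  exact hne (by rw [h1'.1, h2'.1]; simp)

/-- Two cubics without rational roots that share a root in a cubic extension are proportional. -/
theorem exists_eq_scale (hL : Module.finrank k L = 3) {θ : L}
    (hθ : θ ∉ (algebraMap k L).range) {P Q : BinaryCubic k} (hP : ¬ P.HasRoot)
    (hQ : ¬ Q.HasRoot) (hPθ : P.value θ 1 = 0) (hQθ : Q.value θ 1 = 0) :
    ∃ c : k, c ≠ 0 ∧ Q = scale c P := by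
  have hA {R : BinaryCubic k} (hR : ¬ R.HasRoot) : R.coef 3 0 ≠ 0 :=
    fun hA => hR ⟨1, 0, by simp, by simp [value, hA]⟩
  have hAP := hA hP
  have hAQ := hA hQ
  obtain ⟨h1, h2, h3⟩ := eq_zero_of_quadratic_eq_zero hL hθ
    (a := P.coef 3 0 * Q.coef 2 1 - Q.coef 3 0 * P.coef 2 1)
    (b := P.coef 3 0 * Q.coef 1 2 - Q.coef 3 0 * P.coef 1 2)
    (c := P.coef 3 0 * Q.coef 0 3 - Q.coef 3 0 * P.coef 0 3) (by
      simp only [value, map_sub, map_mul] at *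
      linear_combination algebraMap k L (P.coef 3 0) * hQθ - algebraMap k L (Q.coef 3 0) * hPθ)
  refine ⟨Q.coef 3 0 / P.coef 3 0, div_ne_zero hAQ hAP, ext_coef ?_ ?_ ?_ ?_⟩
  · rw [scale, coef_ofCoef_three_zero]; field_simp
  · rw [scale, coef_ofCoef_two_one]; field_simp; linear_combination h1
  · rw [scale, coef_ofCoef_one_two]; field_simp; linear_combination h2
  · rw [scale, coef_ofCoef_zero_three]; field_simp; linear_combination h3

/-- Take `M` carrying a root `θ` of `Q` to a root `φ` of `P`. Then `P ∘ M` and `Q` share the root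
`θ`, so they are proportional. -/
theorem exists_transform_eq_scale [Finite L] (hL : Module.finrank k L = 3) {P Q : BinaryCubic k}
    (hP : ¬ P.HasRoot) (hQ : ¬ Q.HasRoot) :
    ∃ M : Matrix (Fin 2) (Fin 2) k, M.det ≠ 0 ∧ ∃ c : k, c ≠ 0 ∧ transform M P = scale c Q := by
  obtain ⟨φ, hφ, hPφ⟩ := exists_value_eq_zero_of_not_hasRoot hL hP
  obtain ⟨θ, hθ, hQθ⟩ := exists_value_eq_zero_of_not_hasRoot hL hQ
  obtain ⟨a, b, c, d, hdet, hne, hrel⟩ := exists_fractional_linear hL hθ hφ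
  have hM : (!![a, b; c, d]).det ≠ 0 := by rwa [Matrix.det_fin_two_of]
  refine ⟨!![a, b; c, d], hM,
    exists_eq_scale hL hθ hQ (by rwa [hasRoot_transform hM]) hQθ ?_⟩
  rw [value_transform, mul_one, mul_one, hrel]
  have : P.value (φ * (algebraMap k L c * θ + algebraMap k L d))
      (algebraMap k L c * θ + algebraMap k L d)
      = (algebraMap k L c * θ + algebraMap k L d) ^ 3 * P.value φ 1 := by
    simp only [value]
    ring
  rw [this, hPφ, mul_zero]

end CubicExtension

theorem exists_cubic_extension (k : Type*) [Field k] [Finite k] :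
    ∃ (L : Type) (_ : Field L) (_ : Algebra k L), Finite L ∧ Module.finrank k L = 3 := by
  obtain ⟨p, _⟩ := CharP.exists k
  have : Fact p.Prime := ⟨CharP.char_is_prime k p⟩
  exact ⟨FiniteField.Extension k p 3, inferInstance, inferInstance, inferInstance,
    FiniteField.finrank_extension k p 3⟩

theorem exists_not_hasRoot (k : Type*) [Field k] [Finite k] :
    ∃ P : BinaryCubic k, ¬ P.HasRoot := by
  obtain ⟨L, _, _, _, hL⟩ := exists_cubic_extension k
  exact exists_not_hasRoot_of_finrank_eq_three hL

/-! ### Scalings, twists and normal forms. -/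

section NormalForms

variable {k : Type*} [Field k]

theorem disc_scale (c : k) (P : BinaryCubic k) : (scale c P).disc = c ^ 4 * P.disc := by
  rw [eq_ofCoef P, scale]
  simp only [disc_ofCoef, coef_ofCoef_three_zero, coef_ofCoef_two_one, coef_ofCoef_one_two,
    coef_ofCoef_zero_three]
  ring

theorem value_scale (c : k) (P : BinaryCubic k) (x y : k) :
    (scale c P).value x y = c * P.value x y := by
  simp [value, scale]
  ring

theorem hasRoot_scale {c : k} (hc : c ≠ 0) {P : BinaryCubic k} :
    (scale c P).HasRoot ↔ P.HasRoot := by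
  simp only [HasRoot, value_scale, mul_eq_zero, hc, false_or]

/-- The multiple `μ⁻¹ P(μ x, y)`, which runs through the `SL(2)`-classes proportional to a
`GL(2)`-translate of `P`. -/
noncomputable def twist (μ : k) (P : BinaryCubic k) : BinaryCubic k :=
  scale μ⁻¹ (transform !![μ, 0; 0, 1] P)

theorem twist_ofCoef {μ : k} (hμ : μ ≠ 0) (A B C D : k) :
    twist μ (ofCoef A B C D) = ofCoef (μ ^ 2 * A) (μ * B) C (μ⁻¹ * D) := by
  rw [twist, transform_ofCoef, scale]
  simp only [coef_ofCoef_three_zero, coef_ofCoef_two_one, coef_ofCoef_one_two,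
    coef_ofCoef_zero_three]
  congr 1 <;> field_simp <;> ring

theorem hasRoot_twist {μ : k} (hμ : μ ≠ 0) {P : BinaryCubic k} :
    (twist μ P).HasRoot ↔ P.HasRoot := by
  rw [twist, hasRoot_scale (inv_ne_zero hμ), hasRoot_transform]
  simpa [Matrix.det_fin_two_of] using hμ

theorem disc_twist {μ : k} (hμ : μ ≠ 0) (P : BinaryCubic k) :
    (twist μ P).disc = μ ^ 2 * P.disc := by
  rw [twist, disc_scale, disc_transform, Matrix.det_fin_two_of]
  field_simp
  ring

theorem exists_transform_eq_twist {L : Type*} [Field L] [Algebra k L] [Finite L]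
    (hL : Module.finrank k L = 3) {P Q : BinaryCubic k} (hP : ¬ P.HasRoot) (hQ : ¬ Q.HasRoot) :
    ∃ M : Matrix (Fin 2) (Fin 2) k, M.det = 1 ∧ ∃ μ : k, μ ≠ 0 ∧ transform M Q = twist μ P := by
  obtain ⟨M, hM, c, hc, h⟩ := exists_transform_eq_scale hL hQ hP
  obtain ⟨m, hm⟩ : ∃ m, M.det = m := ⟨_, rfl⟩
  rw [hm] at hM
  -- Correct `M` by `diag(s, t)`: determinant one needs `s t = 1 / m`, and fixing the coefficient of
  -- `x y²` needs `c s t² = 1`. Hence `t = m / c`, `s = c / m²` and `μ = s / t`.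
  have hμ : c ^ 2 / m ^ 3 ≠ 0 := div_ne_zero (pow_ne_zero _ hc) (pow_ne_zero _ hM)
  refine ⟨M * !![c / m ^ 2, 0; 0, m / c], ?_, c ^ 2 / m ^ 3, hμ, ?_⟩
  · rw [Matrix.det_mul, Matrix.det_fin_two_of, hm]
    field_simp
    ring
  · obtain ⟨A, B, C, D, rfl⟩ : ∃ A B C D, P = ofCoef A B C D := ⟨_, _, _, _, eq_ofCoef P⟩
    rw [transform_mul, h, twist_ofCoef hμ, scale, transform_ofCoef]
    simp only [coef_ofCoef_three_zero, coef_ofCoef_two_one, coef_ofCoef_one_two,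
      coef_ofCoef_zero_three]
    congr 1 <;> field_simp <;> ring

theorem twist_injective_of_transform_eq (h2 : (2 : k) ≠ 0) (h3 : (3 : k) ≠ 0)
    {P : BinaryCubic k} (hP : ¬ P.HasRoot) {μ ν : k} (hμ : μ ≠ 0) (hν : ν ≠ 0)
    {M : Matrix (Fin 2) (Fin 2) k} (hM : M.det = 1)
    (h : transform M (twist μ P) = twist ν P) : μ = ν := by
  have hd := disc_ne_zero_of_not_hasRoot h2 h3 hP
  have hsq : μ ^ 2 = ν ^ 2 := by
    have := disc_transform M (twist μ P)
    rw [h, hM, disc_twist hμ, disc_twist hν, one_pow, one_mul] at this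
    exact (mul_right_cancel₀ hd this).symm
  rcases sq_eq_sq_iff_eq_or_eq_neg.1 hsq with h' | rfl
  · exact h'
  · exfalso
    -- `diag(1, -1)` exchanges the twists by `ν` and `-ν`; composed with `M` it fixes `twist ν P`
    -- with determinant `-1`.
    refine hP ((hasRoot_twist hν).1 (hasRoot_of_transform_eq_self h2 h3
      (M := !![1, 0; 0, -1] * M) ?_ ?_ ?_))
    · rw [Matrix.det_mul, hM, Matrix.det_fin_two_of]
      ring
    · rw [disc_twist hν]
      exact mul_ne_zero (pow_ne_zero _ hν) hd
    · have hneg : transform !![1, 0; 0, -1] (twist ν P) = twist (-ν) P := by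
        obtain ⟨A, B, C, D, rfl⟩ : ∃ A B C D, P = ofCoef A B C D := ⟨_, _, _, _, eq_ofCoef P⟩
        rw [twist_ofCoef hμ, twist_ofCoef hν, transform_ofCoef, inv_neg]
        congr 1 <;> ring
      rw [transform_mul, hneg, h]

theorem hasRoot_ofCoef (α : k) : (ofCoef α 0 1 0).HasRoot :=
  ⟨0, 1, by simp, by simp [value]⟩

theorem disc_ofCoef_normalForm (α : k) : (ofCoef α 0 1 0).disc = -4 * α := by
  rw [disc_ofCoef]
  ring

end NormalForms

theorem ncard_range_eq_index {G α : Type*} [Group G] (H : Subgroup G) (f : G → α)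
    (h : ∀ a b, f a = f b ↔ a⁻¹ * b ∈ H) : (Set.range f).ncard = H.index := by
  let g : G ⧸ H → α := Quotient.lift (s := QuotientGroup.leftRel H) f
    fun a b hab => (h a b).2 (QuotientGroup.leftRel_apply.1 hab)
  have hg : Function.Injective g := by
    rintro ⟨a⟩ ⟨b⟩ hab
    exact QuotientGroup.eq.2 ((h a b).1 hab)
  have hr : Set.range f = Set.range g :=
    (Set.range_quotient_lift (s := QuotientGroup.leftRel H) _).symm
  rw [hr, Set.ncard_range_of_injective hg]
  rfl

/-! ### Counting orbits. -/

section Orbits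

variable {k : Type*} [Field k]

theorem orbitsDiscNeZero_eq_union {G : Type*} [Group G] [MulAction G (BinaryCubic k)]
    {ι κ : Type*} {f : ι → BinaryCubic k} {g : κ → BinaryCubic k}
    (hf : ∀ i, (f i).disc ≠ 0) (hg : ∀ j, (g j).disc ≠ 0)
    (hr : ∀ P : BinaryCubic k, P.disc ≠ 0 → P.HasRoot → ∃ i, f i ∈ MulAction.orbit G P)
    (hn : ∀ P : BinaryCubic k, ¬ P.HasRoot → ∃ j, g j ∈ MulAction.orbit G P) :
    orbitsDiscNeZero G k = Set.range (fun i => MulAction.orbit G (f i))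
      ∪ Set.range (fun j => MulAction.orbit G (g j)) := by
  ext O
  constructor
  · rintro ⟨P, hP, rfl⟩
    by_cases h : P.HasRoot
    · obtain ⟨i, hi⟩ := hr P hP h
      exact Or.inl ⟨i, MulAction.orbit_eq_iff.2 hi⟩
    · obtain ⟨j, hj⟩ := hn P h
      exact Or.inr ⟨j, MulAction.orbit_eq_iff.2 hj⟩
  · rintro (⟨i, rfl⟩ | ⟨j, rfl⟩)
    · exact ⟨f i, hf i, rfl⟩
    · exact ⟨g j, hg j, rfl⟩

theorem disjoint_range_orbit {G : Type*} [Group G] [MulAction G (BinaryCubic k)]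
    (hG : ∀ P Q : BinaryCubic k, Q ∈ MulAction.orbit G P → Q.HasRoot → P.HasRoot)
    {ι κ : Type*} {f : ι → BinaryCubic k} {g : κ → BinaryCubic k}
    (hf : ∀ i, (f i).HasRoot) (hg : ∀ j, ¬ (g j).HasRoot) :
    Disjoint (Set.range (fun i => MulAction.orbit G (f i)))
      (Set.range (fun j => MulAction.orbit G (g j))) := by
  rw [Set.disjoint_left]
  rintro _ ⟨i, rfl⟩ ⟨j, hj⟩
  exact hg j (hG _ _ (MulAction.orbit_eq_iff.1 hj.symm) (hf i))

theorem orbit_GL_ofCoef_eq_iff (h2 : (2 : k) ≠ 0) (α β : kˣ) :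
    MulAction.orbit (Matrix.GeneralLinearGroup (Fin 2) k) (ofCoef (α : k) 0 1 0)
      = MulAction.orbit (Matrix.GeneralLinearGroup (Fin 2) k) (ofCoef (β : k) 0 1 0)
      ↔ α⁻¹ * β ∈ (powMonoidHom 6 : kˣ →* kˣ).range := by
  rw [eq_comm, MulAction.orbit_eq_iff, mem_orbit_GL]
  constructor
  · rintro ⟨M, hM, h⟩
    refine ⟨Units.mk0 M.det hM, Units.ext ?_⟩
    have := disc_transform M (ofCoef (α : k) 0 1 0)
    rw [h, disc_ofCoef_normalForm, disc_ofCoef_normalForm] at this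
    have h4 : (-4 : k) ≠ 0 := by
      rw [show (-4 : k) = -(2 * 2) by norm_num]
      exact neg_ne_zero.2 (mul_ne_zero h2 h2)
    have : (β : k) = M.det ^ 6 * α := mul_left_cancel₀ h4 (by linear_combination this)
    simp [this]
    field_simp
  · rintro ⟨u, hu⟩
    have hβ : (β : k) = α * u ^ 6 := by
      rw [← Units.val_pow_eq_pow_val, ← Units.val_mul]
      congr 1
      rw [eq_comm, ← eq_inv_mul_iff_mul_eq]
      exact hu
    -- This diagonal matrix fixes `x y²` and multiplies `x³` by `u ^ 6`.
    refine ⟨!![(u : k) ^ 2, 0; 0, (u : k)⁻¹], ?_, ?_⟩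
    · simp [Matrix.det_fin_two_of]
    · rw [transform_ofCoef, hβ]
      congr 1 <;> simp [← pow_mul]

theorem orbit_GL_scale_eq_iff {P : BinaryCubic k} (hP : P.disc ≠ 0) (a b : kˣ) :
    MulAction.orbit (Matrix.GeneralLinearGroup (Fin 2) k) (scale (a : k) P)
      = MulAction.orbit (Matrix.GeneralLinearGroup (Fin 2) k) (scale (b : k) P)
      ↔ a⁻¹ * b ∈ (powMonoidHom 3 : kˣ →* kˣ).range := by
  rw [eq_comm, MulAction.orbit_eq_iff, mem_orbit_GL]
  constructor
  · rintro ⟨M, hM, h⟩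
    have := disc_transform M (scale (a : k) P)
    rw [h, disc_scale, disc_scale, ← mul_assoc] at this
    have := mul_right_cancel₀ hP this
    -- Discriminants give `b ^ 4 = det ^ 6 * a ^ 4`, that is `b / a = (det ^ 2 * a / b) ^ 3`.
    refine ⟨Units.mk0 M.det hM ^ 2 * (a * b⁻¹), Units.ext ?_⟩
    simp
    field_simp
    linear_combination -this
  · rintro ⟨u, hu⟩
    have hb : (b : k) = a * u ^ 3 := by
      rw [← Units.val_pow_eq_pow_val, ← Units.val_mul]
      congr 1
      rw [eq_comm, ← eq_inv_mul_iff_mul_eq]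
      exact hu
    refine ⟨!![(u : k), 0; 0, (u : k)], ?_, ?_⟩
    · simp [Matrix.det_fin_two_of]
    · rw [scale, transform_ofCoef, hb, scale]
      congr 1 <;> ring

variable [Finite k]

theorem ncard_orbitsDiscNeZero_SL (h2 : (2 : k) ≠ 0) (h3 : (3 : k) ≠ 0) :
    (orbitsDiscNeZero (Matrix.SpecialLinearGroup (Fin 2) k) k).ncard
      = 2 * Nat.card kˣ := by
  obtain ⟨P₀, hP₀⟩ := exists_not_hasRoot k
  obtain ⟨L, _, _, _, hL⟩ := exists_cubic_extension k
  have h4 : (-4 : k) ≠ 0 := by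
    rw [show (-4 : k) = -(2 * 2) by norm_num]
    exact neg_ne_zero.2 (mul_ne_zero h2 h2)
  have hdet {M : Matrix (Fin 2) (Fin 2) k} (hM : M.det = 1) : M.det ≠ 0 := by simp [hM]
  rw [orbitsDiscNeZero_eq_union (f := fun α : kˣ => ofCoef (α : k) 0 1 0)
    (g := fun μ : kˣ => twist (μ : k) P₀), Set.ncard_union_eq,
    Set.ncard_range_of_injective, Set.ncard_range_of_injective, two_mul]
  · intro μ ν h
    obtain ⟨M, hM, h⟩ := mem_orbit_SL.1 (MulAction.orbit_eq_iff.1 h.symm)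
    exact Units.ext (twist_injective_of_transform_eq h2 h3 hP₀ μ.ne_zero ν.ne_zero hM h)
  · intro α β h
    obtain ⟨M, hM, h⟩ := mem_orbit_SL.1 (MulAction.orbit_eq_iff.1 h)
    have := disc_transform M (ofCoef (β : k) 0 1 0)
    rw [h, hM, disc_ofCoef_normalForm, disc_ofCoef_normalForm, one_pow, one_mul] at this
    exact Units.ext (mul_left_cancel₀ h4 this)
  · refine disjoint_range_orbit (fun P Q h hQ => ?_) (fun α => hasRoot_ofCoef _)
      fun μ => by rwa [hasRoot_twist μ.ne_zero]
    obtain ⟨M, hM, rfl⟩ := mem_orbit_SL.1 h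
    exact hQ.of_transform (hdet hM)
  · intro α
    rw [disc_ofCoef_normalForm]
    exact mul_ne_zero h4 α.ne_zero
  · intro μ
    rw [disc_twist μ.ne_zero]
    exact mul_ne_zero (pow_ne_zero _ μ.ne_zero) (disc_ne_zero_of_not_hasRoot h2 h3 hP₀)
  · intro P hP hr
    obtain ⟨M, hM, α, hα, h⟩ := hr.exists_transform_eq h2 hP
    exact ⟨Units.mk0 α hα, mem_orbit_SL.2 ⟨M, hM, h⟩⟩
  · intro P hP
    obtain ⟨M, hM, μ, hμ, h⟩ := exists_transform_eq_twist hL hP₀ hP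
    exact ⟨Units.mk0 μ hμ, mem_orbit_SL.2 ⟨M, hM, h⟩⟩

theorem ncard_orbitsDiscNeZero_GL (h2 : (2 : k) ≠ 0) (h3 : (3 : k) ≠ 0) :
    (orbitsDiscNeZero (Matrix.GeneralLinearGroup (Fin 2) k) k).ncard
      = (Nat.card kˣ).gcd 6 + (Nat.card kˣ).gcd 3 := by
  obtain ⟨P₀, hP₀⟩ := exists_not_hasRoot k
  obtain ⟨L, _, _, _, hL⟩ := exists_cubic_extension k
  have hd := disc_ne_zero_of_not_hasRoot h2 h3 hP₀
  have h4 : (-4 : k) ≠ 0 := by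
    rw [show (-4 : k) = -(2 * 2) by norm_num]
    exact neg_ne_zero.2 (mul_ne_zero h2 h2)
  rw [orbitsDiscNeZero_eq_union (f := fun α : kˣ => ofCoef (α : k) 0 1 0)
    (g := fun c : kˣ => scale (c : k) P₀), Set.ncard_union_eq,
    ncard_range_eq_index _ _ (orbit_GL_ofCoef_eq_iff h2),
    ncard_range_eq_index _ _ (orbit_GL_scale_eq_iff hd),
    IsCyclic.index_powMonoidHom_range, IsCyclic.index_powMonoidHom_range]
  · refine disjoint_range_orbit (fun P Q h hQ => ?_) (fun α => hasRoot_ofCoef _)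
      fun c => by rwa [hasRoot_scale c.ne_zero]
    obtain ⟨M, hM, rfl⟩ := mem_orbit_GL.1 h
    exact hQ.of_transform hM
  · intro α
    rw [disc_ofCoef_normalForm]
    exact mul_ne_zero h4 α.ne_zero
  · intro c
    rw [disc_scale]
    exact mul_ne_zero (pow_ne_zero _ c.ne_zero) hd
  · intro P hP hr
    obtain ⟨M, hM, α, hα, h⟩ := hr.exists_transform_eq h2 hP
    exact ⟨Units.mk0 α hα, mem_orbit_GL.2 ⟨M, by simp [hM], h⟩⟩
  · intro P hP
    obtain ⟨M, hM, c, hc, h⟩ := exists_transform_eq_scale hL hP hP₀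
    exact ⟨Units.mk0 c hc, mem_orbit_GL.2 ⟨M, hM, h⟩⟩

end Orbits

end BinaryCubic

theorem mainTheorem12 {k : Type*} [Field k] [Finite k]
    (h2 : ringChar k ≠ 2) (h3 : ringChar k ≠ 3) (q : ℕ) (hq : Nat.card k = q) :
    (BinaryCubic.orbitsDiscNeZero (Matrix.SpecialLinearGroup (Fin 2) k) k).ncard = 2 * (q - 1) ∧
    (q ≡ 1 [MOD 3] →
      (BinaryCubic.orbitsDiscNeZero (Matrix.GeneralLinearGroup (Fin 2) k) k).ncard = 9) ∧
    (q ≡ 2 [MOD 3] →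
      (BinaryCubic.orbitsDiscNeZero (Matrix.GeneralLinearGroup (Fin 2) k) k).ncard = 3) := by
  have two_ne : (2 : k) ≠ 0 := Ring.two_ne_zero h2
  have three_ne : (3 : k) ≠ 0 := by
    intro h
    have hdvd : ringChar k ∣ 3 := (ringChar.spec k 3).1 (by exact_mod_cast h)
    rcases (Nat.dvd_prime Nat.prime_three).1 hdvd with h1 | h1
    · exact CharP.ringChar_ne_one h1
    · exact h3 h1
  have hcard : Nat.card kˣ = q - 1 := by rw [Nat.card_units, hq]
  -- Parity fixes `q - 1` modulo `6` from `q` modulo `3`: the counts are `6 + 3` or `2 + 1`.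
  have hodd : q % 2 = 1 := by
    have := Fintype.ofFinite k
    rw [← hq, Nat.card_eq_fintype_card]
    exact FiniteField.odd_card_of_char_ne_two h2
  rw [BinaryCubic.ncard_orbitsDiscNeZero_SL two_ne three_ne,
    BinaryCubic.ncard_orbitsDiscNeZero_GL two_ne three_ne, hcard]
  refine ⟨rfl, fun h => ?_, fun h => ?_⟩
  · have h6 : 6 ∣ q - 1 := by
      unfold Nat.ModEq at h
      omega
    rw [Nat.gcd_eq_right h6, Nat.gcd_eq_right (Dvd.dvd.trans (by norm_num) h6)]
  · unfold Nat.ModEq at h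
    have e6 : (q - 1) % 6 = 4 := by omega
    have e3 : (q - 1) % 3 = 1 := by omega
    rw [Nat.gcd_comm, Nat.gcd_rec, e6, Nat.gcd_comm (q - 1), Nat.gcd_rec 3, e3]
    norm_num
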